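/- For integers $k \ge 1$ and $m \ge 0$ let $K = T(3,3k+1;2m)$ be the twisted torus knot, that is, the closure of the positive $3$-braid $(\sigma_2\sigma_1)^{3k+1}\sigma_2^{2m}$, where the Artin generators $\sigma_1,\sigma_2$ are represented by positive crossings. Let $\sigma(K)$ be the signature of $K$, that is, the signature of $V + V^{T}$ for a Seifert matrix $V$ of $K$ (so that the right-handed trefoil has signature $-2$). Then $$\sigma(K) = \begin{cases} -4k-2m-2 & \text{if } k \text{ is odd and } m \in \{0,1\},\\ -4k-2m & \text{otherwise.}\end{cases}$$ -/

import Mathlib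

/-- A braid word on `gens + 1` strands. The letter `(i, true)` is the Artin generator `σ_{i+1}`
(with a positive crossing between the strands at heights `i` and `i + 1`), and `(i, false)` is its
inverse. The word is read from left to right. -/
structure BraidWord where
  gens : ℕ
  word : List (Fin gens × Bool)

/-- The moves on braid words that generate equivalence of closures as oriented links in `S³`:
equality in the braid group (`cancel`, `comm`, `braid`: Artin's presentation), conjugation
(`conj`, moving the first letter to the end) and stabilization (`stab`). By the theorems of
Alexander and Markov, oriented links up to isotopy are exactly the braid words modulo the
equivalence relation generated by these moves. -/
inductive MarkovMove : BraidWord → BraidWord → Prop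
  | cancel (n : ℕ) (u v : List (Fin n × Bool)) (i : Fin n) (e : Bool) :
      MarkovMove ⟨n, u ++ v⟩ ⟨n, u ++ [(i, e), (i, !e)] ++ v⟩
  | comm (n : ℕ) (u v : List (Fin n × Bool)) (i j : Fin n) (hij : (i : ℕ) + 1 < j) :
      MarkovMove ⟨n, u ++ [(i, true), (j, true)] ++ v⟩ ⟨n, u ++ [(j, true), (i, true)] ++ v⟩
  | braid (n : ℕ) (u v : List (Fin n × Bool)) (i j : Fin n) (hij : (i : ℕ) + 1 = j) :
      MarkovMove ⟨n, u ++ [(i, true), (j, true), (i, true)] ++ v⟩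
        ⟨n, u ++ [(j, true), (i, true), (j, true)] ++ v⟩
  | conj (n : ℕ) (x : Fin n × Bool) (u : List (Fin n × Bool)) :
      MarkovMove ⟨n, x :: u⟩ ⟨n, u ++ [x]⟩
  | stab (n : ℕ) (u : List (Fin n × Bool)) (e : Bool) :
      MarkovMove ⟨n, u⟩ ⟨n + 1, u.map (fun x => (x.1.castSucc, x.2)) ++ [(Fin.last n, e)]⟩

/-- Oriented link types in `S³`, as closures of braids: braid words modulo the equivalence relation
generated by the Markov moves. -/
def LinkType : Type := Quot MarkovMove

namespace BraidWord

/-- The oriented link type of the closure of a braid word. -/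
def closure (w : BraidWord) : LinkType := Quot.mk MarkovMove w

/-- The index of the generator at position `t` of the word. -/
def gen (w : BraidWord) (t : Fin w.word.length) : Fin w.gens := (w.word.get t).1

/-- The sign `±1` of the crossing at position `t` of the word. -/
def sign (w : BraidWord) (t : Fin w.word.length) : ℤ := if (w.word.get t).2 then 1 else -1

/-- Seifert's algorithm, applied to the closure of `w`, gives a Seifert surface made of one disk
`D_i` per strand `i`, the disks lying above one another with upward positive normals, and of one
half-twisted band for each letter: the letter at position `t`, with generator index `i`, gives a
band that joins `D_i` to `D_{i+1}` at the front, at horizontal coordinate `t`, twisted according to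
the sign of the letter.

The first homology of this surface is free on the following loops: one for each pair of successive
occurrences `s < t` of the same generator index `i`. The loop runs up the band `s` from `D_i` to
`D_{i+1}`, then through `D_{i+1}` to the band `t`, down the band `t`, and through `D_i` back to the
band `s`. -/
abbrev Loop (w : BraidWord) : Type :=
  {p : Fin w.word.length × Fin w.word.length //
    p.1 < p.2 ∧ w.gen p.1 = w.gen p.2 ∧ ∀ r, p.1 < r → r < p.2 → w.gen r ≠ w.gen p.1}

/-- The Seifert matrix of the Seifert surface of the closure of `w` described at `BraidWord.Loop`.
The entry at `x`, `y` is the linking number `lk(x, y⁺)` of the loop `x` with the push-off `y⁺` of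
the loop `y` in the direction of the positive normal of the surface:

* `lk(x, x⁺)` is minus half the sum of the signs of the two bands through which `x` runs;
* if `x` and `y` are different loops between the same two disks, they link only if they share a
  band, the second band of one being the first band of the other, and then the linking number
  depends on the sign of that band and on which of the two loops comes first;
* if `x` lies between `D_{i+1}` and `D_{i+2}` and `y` between `D_i` and `D_{i+1}`, then `x` and
  `y⁺` link only if `x` and `y` cross in `D_{i+1}`, that is, if the positions of their bands
  interleave; for the opposite positions of `x` and `y`, the loop `y⁺` is above `x` and the two
  are not linked;
* loops with no disk in common are not linked. -/
def seifertMatrix (w : BraidWord) : Matrix w.Loop w.Loop ℤ :=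
  Matrix.of fun x y =>
    let s := x.val.1
    let t := x.val.2
    let s' := y.val.1
    let t' := y.val.2
    if x = y then -((w.sign s + w.sign t) / 2)
    else if t = s' then (if w.sign t = -1 then -1 else 0)
    else if t' = s then (if w.sign s = 1 then 1 else 0)
    else if (w.gen s : ℕ) = w.gen s' + 1 then
      (if s < s' ∧ s' < t ∧ t < t' then 1
      else if s' < s ∧ s < t' ∧ t' < t then -1
      else 0)
    else 0

end BraidWord

/-- The signature of a real symmetric matrix `A`: the number of positive squares minus the number
of negative squares in a diagonalization of the quadratic form `x ↦ xᵀ A x`. -/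
noncomputable def Matrix.realSignature {ι : Type*} [Fintype ι] [DecidableEq ι]
    (A : Matrix ι ι ℝ) : ℤ :=
  (sigPos A.toQuadraticForm' : ℤ) - (sigNeg A.toQuadraticForm' : ℤ)

/-- The signature of `V + Vᵀ`, where `V` is the Seifert matrix of the closure of `w`. -/
noncomputable def BraidWord.signature (w : BraidWord) : ℤ :=
  ((w.seifertMatrix + w.seifertMatrix.transpose).map (Int.cast : ℤ → ℝ)).realSignature

/-- `L.HasSignature s` says that the link type `L` has signature `σ(L) = s`: for every presentation
of `L` as the closure of a braid, the symmetrized Seifert matrix has signature `s`. Every link type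
has such a presentation, so `s` is determined by `L`. -/
def LinkType.HasSignature (L : LinkType) (s : ℤ) : Prop :=
  ∀ w : BraidWord, w.closure = L → w.signature = s

/-- The braid word `(σ₂σ₁)^q σ₂^r` on three strands. -/
def twistedTorusBraid (q r : ℕ) : BraidWord where
  gens := 2
  word := (List.replicate q [((1 : Fin 2), true), ((0 : Fin 2), true)]).flatten ++
    List.replicate r ((1 : Fin 2), true)

/-- The twisted torus link `T(3, q; r)`, the closure of `(σ₂σ₁)^q σ₂^r`. -/
def twistedTorusLink (q r : ℕ) : LinkType := (twistedTorusBraid q r).closure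

/-!
On the chains of bands of the Seifert surface of a braid closure there is a quadratic form that
restricts, on the chains with boundary zero, to the symmetrized Seifert form. Unlike the Seifert
form it is local: concatenating words adds the forms, up to a linking term that depends only on the
boundaries. Hence the Markov relations, and all other simplifications, can be checked on subwords,
as isometries preserving the boundary, up to planes `p d` in which only `p` has a boundary; these
split off a hyperbolic plane or vanish, and do not change the signature.

Locally the full twist `(σ₂σ₁)³` is four negative squares and a plane with form `p q`, in which
the chain `(p, q)` has boundary `p e₀ + q e₁`. Two such planes cancel, so only the parity of `k`
matters, and `σ₂ ^ (r + 1)` is `r` negative squares and a single band of form `-b² / (r + 1)`.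
For even `k` the closure of the remaining two bands has no cycles. For odd `k` there is one plane
`p q`; on cycles `p = -a` and `q = -b`, which leaves
`-b² / (r + 1) + a b - a² = -(a - b / 2)² + (1 / 4 - 1 / (r + 1)) b²`.
The last coefficient changes its sign at `r = 3`.
-/

section Signature

variable {𝕜 M M' : Type*} [Field 𝕜] [LinearOrder 𝕜] [AddCommGroup M] [Module 𝕜 M]
  [AddCommGroup M'] [Module 𝕜 M']

/-- The signature of a quadratic form over an ordered field: the number of positive squares minus
the number of negative squares in a diagonalization. -/
noncomputable def formSignature (Q : QuadraticForm 𝕜 M) : ℤ := (sigPos Q : ℤ) - sigNeg Q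

theorem formSignature_eq_sum_sign [IsStrictOrderedRing 𝕜] {ι : Type*} [Fintype ι]
    {Q : QuadraticForm 𝕜 M} {w : ι → 𝕜}
    (h : Q.Equivalent (QuadraticMap.weightedSumSquares 𝕜 w)) :
    formSignature Q = ∑ i, (SignType.sign (w i) : ℤ) := by
  classical
  rw [formSignature, QuadraticForm.sigPos_of_equiv_weightedSumSquares h,
    QuadraticForm.sigNeg_of_equiv_weightedSumSquares h, Set.ncard_eq_toFinset_card',
    Set.ncard_eq_toFinset_card', Set.toFinset_ofPred, Set.toFinset_ofPred, Finset.card_filter,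
    Finset.card_filter, Nat.cast_sum, Nat.cast_sum, ← Finset.sum_sub_distrib]
  refine Finset.sum_congr rfl fun i _ => ?_
  rcases lt_trichotomy (w i) 0 with h | h | h <;> simp [h, h.not_gt]

theorem finrank_le_sigPos_of_linearMap [FiniteDimensional 𝕜 M] {Q : QuadraticForm 𝕜 M}
    (f : M' →ₗ[𝕜] M) (hf : ∀ x, x ≠ 0 → 0 < Q (f x)) : Module.finrank 𝕜 M' ≤ sigPos Q := by
  have hinj : Function.Injective f := (injective_iff_map_eq_zero f).2 fun x hx => by
    by_contra h0
    simpa [hx] using hf x h0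
  rw [← LinearMap.finrank_range_of_inj hinj]
  refine le_sigPos_of_posDef Q ?_
  rintro ⟨_, x, rfl⟩ h0
  exact hf x fun hx => h0 (by simp [hx])

theorem formSignature_zero : formSignature (0 : QuadraticForm 𝕜 M) = 0 := by
  rw [formSignature, ← sigPos_neg, neg_zero, sub_self]

variable [FiniteDimensional 𝕜 M] [FiniteDimensional 𝕜 M']

theorem sigPos_le_sigPos_of_linearMap {Q : QuadraticForm 𝕜 M} {Q' : QuadraticForm 𝕜 M'}
    (f : M →ₗ[𝕜] M') (hf : ∀ x, Q x ≤ Q' (f x)) : sigPos Q ≤ sigPos Q' := by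
  obtain ⟨U, hU, hpos⟩ := exists_finrank_eq_sigPos_and_posDef Q
  rw [← hU]
  exact finrank_le_sigPos_of_linearMap (f ∘ₗ U.subtype) fun x hx => (hpos x hx).trans_le (hf x)

theorem sigPos_eq_of_surjective {Q : QuadraticForm 𝕜 M} {Q' : QuadraticForm 𝕜 M'}
    (f : Q →qᵢ Q') (hf : Function.Surjective f) : sigPos Q = sigPos Q' := by
  obtain ⟨g, hg⟩ := f.toLinearMap.exists_rightInverse_of_surjective (LinearMap.range_eq_top.2 hf)
  refine le_antisymm (sigPos_le_sigPos_of_linearMap f.toLinearMap fun x => (f.map_app x).ge)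
    (sigPos_le_sigPos_of_linearMap g fun x => ?_)
  have hfg : f (g x) = x := LinearMap.congr_fun hg x
  rw [← f.map_app, hfg]

theorem formSignature_eq_of_surjective {Q : QuadraticForm 𝕜 M} {Q' : QuadraticForm 𝕜 M'}
    (f : Q →qᵢ Q') (hf : Function.Surjective f) : formSignature Q = formSignature Q' := by
  let f' : (-Q) →qᵢ (-Q') := ⟨f.toLinearMap, fun x => congrArg Neg.neg (f.map_app x)⟩
  rw [formSignature, formSignature, sigPos_eq_of_surjective f hf, ← sigPos_neg, ← sigPos_neg,
    sigPos_eq_of_surjective f' hf]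

theorem sigPos_le_sigPos_restrict_ker_add_one (Q : QuadraticForm 𝕜 M) (l : M →ₗ[𝕜] 𝕜) :
    sigPos Q ≤ sigPos (Q.restrict (LinearMap.ker l)) + 1 := by
  obtain ⟨U, hU, hpos⟩ := exists_finrank_eq_sigPos_and_posDef Q
  let lU : U →ₗ[𝕜] 𝕜 := l ∘ₗ U.subtype
  have hrange : Module.finrank 𝕜 (LinearMap.range lU) ≤ 1 := by
    simpa using Submodule.finrank_le (LinearMap.range lU)
  have hker : Module.finrank 𝕜 (LinearMap.ker lU) ≤ sigPos (Q.restrict (LinearMap.ker l)) :=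
    finrank_le_sigPos_of_linearMap (U.subtype.restrict fun _ h => h) fun x hx =>
      hpos x fun h => hx (Subtype.ext h)
  have := lU.finrank_range_add_finrank_ker
  omega

variable [IsStrictOrderedRing 𝕜]

theorem sigPos_eq_sigPos_restrict_ker_polar_add_one {Q : QuadraticForm 𝕜 M} {e : M} (he : Q e = 0)
    (hne : Q.polarBilin e ≠ 0) :
    sigPos Q = sigPos (Q.restrict (LinearMap.ker (Q.polarBilin e))) + 1 := by
  refine le_antisymm (sigPos_le_sigPos_restrict_ker_add_one Q _) ?_
  obtain ⟨U, hU, hpos⟩ :=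
    exists_finrank_eq_sigPos_and_posDef (Q.restrict (LinearMap.ker (Q.polarBilin e)))
  obtain ⟨v, hv⟩ := LinearMap.surjective hne 1
  let ι : U →ₗ[𝕜] M := (LinearMap.ker (Q.polarBilin e)).subtype ∘ₗ U.subtype
  -- The multiple of `e` is chosen so that `v` becomes a unit vector orthogonal to `U`.
  let f : U × 𝕜 →ₗ[𝕜] M := ι.coprod (LinearMap.toSpanSingleton 𝕜 M v) +
    ((1 - Q v) • LinearMap.snd 𝕜 U 𝕜 - Q.polarBilin v ∘ₗ ι ∘ₗ LinearMap.fst 𝕜 U 𝕜).smulRight e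
  have hf : ∀ u s, Q (f (u, s)) = Q (ι u) + s * s := by
    intro u s
    have hue : QuadraticMap.polar Q e (ι u) = 0 := u.1.2
    have hve : QuadraticMap.polar Q e v = 1 := hv
    simp [f, QuadraticMap.map_add Q, QuadraticMap.map_smul,
      QuadraticMap.polar_smul_right, QuadraticMap.polar_comm Q _ e, he, hue, hve,
      QuadraticMap.polar_comm Q (ι u) v, -QuadraticMap.polar_sub_right]
    ring
  have hdim : Module.finrank 𝕜 (U × 𝕜) =
      sigPos (Q.restrict (LinearMap.ker (Q.polarBilin e))) + 1 := by simp [hU]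
  rw [← hdim]
  refine finrank_le_sigPos_of_linearMap f ?_
  rintro ⟨u, s⟩ hus
  rw [hf]
  rcases eq_or_ne u 0 with rfl | hu
  · have hs : s ≠ 0 := by rintro rfl; exact hus rfl
    simpa using mul_self_pos.2 hs
  · exact add_pos_of_pos_of_nonneg (hpos u hu) (mul_self_nonneg s)

theorem formSignature_eq_restrict_ker_polar {Q : QuadraticForm 𝕜 M} {e : M} (he : Q e = 0) :
    formSignature Q = formSignature (Q.restrict (LinearMap.ker (Q.polarBilin e))) := by
  by_cases hne : Q.polarBilin e = 0
  · let incl : Q.restrict (LinearMap.ker (Q.polarBilin e)) →qᵢ Q :=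
      ⟨Submodule.subtype _, fun _ => rfl⟩
    exact (formSignature_eq_of_surjective incl fun x => ⟨⟨x, by simp [hne]⟩, rfl⟩).symm
  · have hpolar : (-Q).polarBilin e = -Q.polarBilin e := by
      ext x
      exact QuadraticMap.polar_neg Q e x
    have hneg := sigPos_eq_sigPos_restrict_ker_polar_add_one (Q := -Q) (e := e) (by simp [he])
      (by simpa [hpolar] using hne)
    have hker : LinearMap.ker ((-Q).polarBilin e) = LinearMap.ker (Q.polarBilin e) := by
      ext x
      simp [hpolar]
    have hrestrict : (-Q).restrict (LinearMap.ker (Q.polarBilin e)) =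
      -Q.restrict (LinearMap.ker (Q.polarBilin e)) := rfl
    rw [hker, hrestrict, sigPos_neg, sigPos_neg] at hneg
    rw [formSignature, formSignature, sigPos_eq_sigPos_restrict_ker_polar_add_one he hne, hneg]
    push_cast
    ring

theorem formSignature_prod (Q : QuadraticForm 𝕜 M) (Q' : QuadraticForm 𝕜 M') :
    formSignature (Q.prod Q') = formSignature Q + formSignature Q' := by
  have : Invertible (2 : 𝕜) := invertibleOfNonzero two_ne_zero
  obtain ⟨w, hw⟩ := Q.equivalent_weightedSumSquares
  obtain ⟨w', hw'⟩ := Q'.equivalent_weightedSumSquares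
  have hsum : ((QuadraticMap.weightedSumSquares 𝕜 w).prod
      (QuadraticMap.weightedSumSquares 𝕜 w')).Equivalent
      (QuadraticMap.weightedSumSquares 𝕜 (Sum.elim w w')) :=
    ⟨{ (LinearEquiv.sumArrowLequivProdArrow _ _ 𝕜 𝕜).symm with
        map_app' := fun x => by
          simp only [QuadraticMap.weightedSumSquares_apply, QuadraticMap.prod_apply]
          exact Fintype.sum_sum_type _ }⟩
  rw [formSignature_eq_sum_sign ((hw.prod hw').trans hsum), formSignature_eq_sum_sign hw,
    formSignature_eq_sum_sign hw', Fintype.sum_sum_type]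
  rfl

theorem formSignature_smul_sq (c : 𝕜) :
    formSignature (c • QuadraticMap.sq : QuadraticForm 𝕜 𝕜) = SignType.sign c := by
  have h : (c • QuadraticMap.sq : QuadraticForm 𝕜 𝕜).Equivalent
      (QuadraticMap.weightedSumSquares 𝕜 fun _ : Unit => c) :=
    ⟨{ (LinearEquiv.funUnique Unit 𝕜 𝕜).symm with
        map_app' := fun x => by simp [QuadraticMap.weightedSumSquares_apply] }⟩
  rw [formSignature_eq_sum_sign h, Fintype.sum_unique]

end Signature

section BandSpace

/-- The space of chains of bands of a piece of a surface built from disks `D₀, D₁, …` (with upward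
normals) and bands between them. The boundary of a chain is recorded with `eᵢ` standing for
`Dᵢ₊₁ - Dᵢ`, so that the cycles, which are the first homology of the surface, are the chains with
boundary zero; `form` is a quadratic form on all chains which on the cycles is the symmetrized
Seifert form. -/
structure BandSpace where
  Chain : Type
  [addCommGroup : AddCommGroup Chain]
  [module : Module ℝ Chain]
  [finiteDimensional : FiniteDimensional ℝ Chain]
  form : QuadraticForm ℝ Chain
  boundary : Chain →ₗ[ℝ] (ℕ →₀ ℝ)

namespace BandSpace

attribute [instance] addCommGroup module finiteDimensional

/-- The bilinear form on boundaries with `⟨eᵢ₊₁, eᵢ⟩ = 1` and all other products of basis vectors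
zero. It is the linking of two chains of which the first lies to the left of the second. -/
noncomputable def pairing : (ℕ →₀ ℝ) →ₗ[ℝ] (ℕ →₀ ℝ) →ₗ[ℝ] ℝ :=
  Finsupp.linearCombination ℝ fun i =>
    Finsupp.linearCombination ℝ fun j => if i = j + 1 then (1 : ℝ) else 0

theorem pairing_single_single (i j : ℕ) (a b : ℝ) :
    pairing (Finsupp.single i a) (Finsupp.single j b) = if i = j + 1 then a * b else 0 := by
  simp [pairing]

/-- Juxtaposition of two pieces of a surface, the first one to the left of the second one. -/
@[reducible]
noncomputable def concat (A B : BandSpace) : BandSpace where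
  Chain := A.Chain × B.Chain
  form := A.form.prod B.form +
    (2 : ℝ) • LinearMap.BilinMap.toQuadraticMap
      (pairing.compl₁₂ (A.boundary ∘ₗ LinearMap.fst ℝ _ _) (B.boundary ∘ₗ LinearMap.snd ℝ _ _))
  boundary := A.boundary.coprod B.boundary

theorem concat_form (A B : BandSpace) (x : A.Chain × B.Chain) :
    (A.concat B).form x =
      A.form x.1 + B.form x.2 + 2 * pairing (A.boundary x.1) (B.boundary x.2) := by
  simp

theorem concat_boundary (A B : BandSpace) (x : A.Chain × B.Chain) :
    (A.concat B).boundary x = A.boundary x.1 + B.boundary x.2 := by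
  simp

/-- The empty piece of a surface. -/
@[reducible]
noncomputable def empty : BandSpace where
  Chain := PUnit
  form := 0
  boundary := 0

/-- A single half-twisted band between `Dᵢ` and `Dᵢ₊₁`, of weight `1` or `-1` according to the sign
of the crossing. A real weight `w` behaves like `1 / w` positive crossings in a row. -/
@[reducible]
noncomputable def letter (i : ℕ) (w : ℝ) : BandSpace where
  Chain := ℝ
  form := -w • QuadraticMap.sq
  boundary := Finsupp.lsingle i

/-- A direct summand `c x²` of the form that consists of cycles. -/
@[reducible]
noncomputable def line (c : ℝ) : BandSpace where
  Chain := ℝ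
  form := c • QuadraticMap.sq
  boundary := 0

/-- The form `p d`, with only `p` contributing to the boundary. -/
@[reducible]
noncomputable def hyperbolic (i : ℕ) : BandSpace where
  Chain := ℝ × ℝ
  form := QuadraticMap.linMulLin (LinearMap.fst ℝ ℝ ℝ) (LinearMap.snd ℝ ℝ ℝ)
  boundary := Finsupp.lsingle i ∘ₗ LinearMap.fst ℝ ℝ ℝ

/-- The form `p q` on a plane in which the chain `(p, q)` has the boundary `p e₀ + q e₁`: what
remains of a full twist on three strands when its four negative squares are split off. -/
@[reducible]
noncomputable def twistPlane : BandSpace where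
  Chain := ℝ × ℝ
  form := QuadraticMap.linMulLin (LinearMap.fst ℝ ℝ ℝ) (LinearMap.snd ℝ ℝ ℝ)
  boundary := (Finsupp.lsingle 0).coprod (Finsupp.lsingle 1)

theorem empty_form (x : PUnit) : empty.form x = 0 := rfl

theorem empty_boundary (x : PUnit) : empty.boundary x = 0 := rfl

theorem letter_form (i : ℕ) (w a : ℝ) : (letter i w).form a = -(w * (a * a)) := by
  simp

theorem letter_boundary (i : ℕ) (w a : ℝ) : (letter i w).boundary a = Finsupp.single i a := rfl

theorem line_form (c t : ℝ) : (line c).form t = c * (t * t) := rfl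

theorem line_boundary (c t : ℝ) : (line c).boundary t = 0 := rfl

theorem hyperbolic_form (i : ℕ) (x : ℝ × ℝ) : (hyperbolic i).form x = x.1 * x.2 := rfl

theorem hyperbolic_boundary (i : ℕ) (x : ℝ × ℝ) :
    (hyperbolic i).boundary x = Finsupp.single i x.1 := rfl

theorem twistPlane_form (x : ℝ × ℝ) : twistPlane.form x = x.1 * x.2 := rfl

theorem twistPlane_boundary (x : ℝ × ℝ) :
    twistPlane.boundary x = Finsupp.single 0 x.1 + Finsupp.single 1 x.2 := by
  simp

/-- The signature of the form on the cycles. -/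
noncomputable def sig (A : BandSpace) : ℤ :=
  formSignature (A.form.restrict (LinearMap.ker A.boundary))

theorem sig_empty : empty.sig = 0 := formSignature_zero

variable {A B : BandSpace}

theorem sig_eq_of_surjOn_ker (f : A.Chain →ₗ[ℝ] B.Chain)
    (hker : ∀ x, A.boundary x = 0 → B.boundary (f x) = 0)
    (hsurj : ∀ y, B.boundary y = 0 → ∃ x, A.boundary x = 0 ∧ f x = y)
    (hform : ∀ x, A.boundary x = 0 → B.form (f x) = A.form x) : A.sig = B.sig := by
  let g : A.form.restrict (LinearMap.ker A.boundary) →qᵢ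
      B.form.restrict (LinearMap.ker B.boundary) := ⟨f.restrict hker, fun x => hform x x.2⟩
  refine formSignature_eq_of_surjective g ?_
  rintro ⟨y, hy⟩
  obtain ⟨x, hx, rfl⟩ := hsurj y hy
  exact ⟨⟨x, hx⟩, rfl⟩

theorem sig_eq_of_surjective (f : A.Chain →ₗ[ℝ] B.Chain) (hsurj : Function.Surjective f)
    (hform : ∀ x, B.form (f x) = A.form x) (hboundary : ∀ x, B.boundary (f x) = A.boundary x) :
    A.sig = B.sig := by
  refine sig_eq_of_surjOn_ker f (fun x hx => (hboundary x).trans hx) (fun y hy => ?_)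
    fun x _ => hform x
  obtain ⟨x, rfl⟩ := hsurj y
  exact ⟨x, (hboundary x).symm.trans hy, rfl⟩

theorem sig_concat_comm (A B : BandSpace) : (A.concat B).sig = (B.concat A).sig := by
  refine sig_eq_of_surjOn_ker (LinearEquiv.prodComm ℝ A.Chain B.Chain).toLinearMap ?_ ?_ ?_
  · rintro ⟨x, y⟩ h
    simpa [add_comm] using h
  · rintro ⟨y, x⟩ h
    exact ⟨(x, y), by simpa [add_comm] using h, rfl⟩
  · rintro ⟨x, y⟩ h
    have hy : B.boundary y = -A.boundary x :=
      eq_neg_of_add_eq_zero_right (by simpa using h)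
    simp [hy, add_comm]

theorem sig_concat_empty (A : BandSpace) : (A.concat empty).sig = A.sig := by
  refine sig_eq_of_surjective (LinearMap.fst ℝ A.Chain PUnit) Prod.fst_surjective ?_ ?_ <;>
    rintro ⟨x, y⟩ <;> simp

theorem sig_line_concat (c : ℝ) (X : BandSpace) :
    ((line c).concat X).sig = SignType.sign c + X.sig := by
  let f : ℝ × LinearMap.ker X.boundary →ₗ[ℝ] LinearMap.ker ((line c).concat X).boundary :=
    (LinearMap.id.prodMap (Submodule.subtype _)).codRestrict _ fun x => by simp
  let g : (c • QuadraticMap.sq : QuadraticForm ℝ ℝ).prod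
      (X.form.restrict (LinearMap.ker X.boundary)) →qᵢ
      ((line c).concat X).form.restrict (LinearMap.ker ((line c).concat X).boundary) :=
    ⟨f, fun x => by
      change ((line c).concat X).form (x.1, x.2) = _
      simp⟩
  rw [sig, ← formSignature_eq_of_surjective g, formSignature_prod, formSignature_smul_sq, sig]
  rintro ⟨⟨t, x⟩, h⟩
  exact ⟨(t, ⟨x, by simpa using h⟩), rfl⟩

theorem sig_hyperbolic_concat (i : ℕ) (X : BandSpace) : ((hyperbolic i).concat X).sig = X.sig := by
  let K := LinearMap.ker ((hyperbolic i).concat X).boundary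
  let Q : QuadraticForm ℝ K := ((hyperbolic i).concat X).form.restrict K
  let e : K := ⟨((0, 1), 0), by simp [K]⟩
  have he : Q e = 0 := by simp [Q, e]
  have hpolar : ∀ x : K, Q.polarBilin e x = x.1.1.1 := by
    rintro ⟨⟨⟨p, d⟩, x⟩, h⟩
    change ((hyperbolic i).concat X).form ((0, 1) + (p, d), 0 + x) -
      ((hyperbolic i).concat X).form ((0, 1), 0) - ((hyperbolic i).concat X).form ((p, d), x) = p
    simp only [↓concat_form, ↓hyperbolic_form, ↓hyperbolic_boundary, Prod.mk_add_mk, zero_add,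
      map_zero, Finsupp.single_zero]
    ring
  have hcycle : ∀ x : LinearMap.ker (Q.polarBilin e), X.boundary x.1.1.2 = 0 := by
    rintro ⟨⟨⟨⟨p, d⟩, x⟩, h⟩, hp⟩
    obtain rfl : p = 0 := (hpolar _).symm.trans hp
    simpa [K] using h
  let f : LinearMap.ker (Q.polarBilin e) →ₗ[ℝ] LinearMap.ker X.boundary :=
    (LinearMap.snd ℝ (ℝ × ℝ) X.Chain ∘ₗ K.subtype ∘ₗ Submodule.subtype _).codRestrict _ hcycle
  let g : Q.restrict (LinearMap.ker (Q.polarBilin e)) →qᵢ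
      X.form.restrict (LinearMap.ker X.boundary) := ⟨f, by
    rintro ⟨⟨⟨⟨p, d⟩, x⟩, h⟩, hp⟩
    obtain rfl : p = 0 := (hpolar _).symm.trans hp
    change X.form x = ((hyperbolic i).concat X).form ((0, d), x)
    simp⟩
  refine (formSignature_eq_restrict_ker_polar he).trans (formSignature_eq_of_surjective g ?_)
  rintro ⟨x, hx⟩
  have hxK : ((0, 0), x) ∈ K := by simpa [K] using hx
  exact ⟨⟨⟨((0, 0), x), hxK⟩, hpolar _⟩, rfl⟩

theorem sig_concat_letter_of_boundary_eq_zero {i : ℕ} (h : ∀ x, A.boundary x i = 0) (w : ℝ) :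
    (A.concat (letter i w)).sig = A.sig := by
  refine (sig_eq_of_surjOn_ker (LinearMap.inl ℝ A.Chain ℝ) ?_ ?_ ?_).symm
  · intro x hx
    simpa using hx
  · rintro ⟨x, a⟩ hx
    have hxa : A.boundary x + Finsupp.single i a = 0 := by simpa using hx
    obtain rfl : a = 0 := by simpa [h] using DFunLike.congr_fun hxa i
    exact ⟨x, by simpa using hxa, rfl⟩
  · intro x _
    simp

end BandSpace

end BandSpace

section BandClass

namespace BandSpace

/-- Two pieces of a surface are equivalent if they can replace each other in every surface without
changing the signature. -/
instance signatureSetoid : Setoid BandSpace where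
  r A B := ∀ X, (A.concat X).sig = (B.concat X).sig
  iseqv := ⟨fun _ _ => rfl, fun h X => (h X).symm, fun h h' X => (h X).trans (h' X)⟩

theorem equiv_of_isometry {A B : BandSpace} (f : A.Chain →ₗ[ℝ] B.Chain)
    (hsurj : Function.Surjective f) (hform : ∀ x, B.form (f x) = A.form x)
    (hboundary : ∀ x, B.boundary (f x) = A.boundary x) : A ≈ B := fun X => by
  refine sig_eq_of_surjective (f.prodMap LinearMap.id) (hsurj.prodMap Function.surjective_id) ?_ ?_
    <;> rintro ⟨x, y⟩ <;> simp [hform, hboundary]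

theorem sig_eq_of_equiv {A B : BandSpace} (h : A ≈ B) : A.sig = B.sig := by
  rw [← sig_concat_empty A, h, sig_concat_empty]

theorem concat_assoc_equiv (A B C : BandSpace) :
    (A.concat B).concat C ≈ A.concat (B.concat C) := by
  refine equiv_of_isometry (LinearEquiv.prodAssoc ℝ A.Chain B.Chain C.Chain).toLinearMap
    (LinearEquiv.surjective _) ?_ ?_ <;> rintro ⟨⟨x, y⟩, z⟩
  · change (A.concat (B.concat C)).form (x, (y, z)) = _
    simp only [↓concat_form, ↓concat_boundary, map_add, LinearMap.add_apply]
    ring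
  · simp [add_assoc]

theorem sig_concat_assoc (A B C : BandSpace) :
    ((A.concat B).concat C).sig = (A.concat (B.concat C)).sig :=
  sig_eq_of_equiv (concat_assoc_equiv A B C)

theorem concat_congr {A A' B B' : BandSpace} (hA : A ≈ A') (hB : B ≈ B') :
    A.concat B ≈ A'.concat B' := fun X => calc
  ((A.concat B).concat X).sig = (A'.concat (B.concat X)).sig := by rw [sig_concat_assoc, hA]
  _ = (B'.concat (X.concat A')).sig := by rw [sig_concat_comm, sig_concat_assoc, hB]
  _ = ((A'.concat B').concat X).sig := by
    rw [← sig_concat_assoc, sig_concat_comm, sig_concat_assoc]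

end BandSpace

/-- The monoid of pieces of a surface under juxtaposition, up to local equivalence. It stands in
for the braid group in the computation of signatures. -/
def BandClass : Type 1 := Quotient BandSpace.signatureSetoid

namespace BandSpace

/-- The class of a piece of a surface. -/
def toClass (A : BandSpace) : BandClass := Quotient.mk signatureSetoid A

theorem toClass_eq_of_isometry {A B : BandSpace} (f : A.Chain →ₗ[ℝ] B.Chain)
    (hsurj : Function.Surjective f) (hform : ∀ x, B.form (f x) = A.form x)
    (hboundary : ∀ x, B.boundary (f x) = A.boundary x) : A.toClass = B.toClass :=
  Quotient.sound (equiv_of_isometry f hsurj hform hboundary)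

end BandSpace

namespace BandClass

open BandSpace

noncomputable instance : Monoid BandClass where
  mul := Quotient.map₂ concat fun _ _ hA _ _ hB => concat_congr hA hB
  one := empty.toClass
  mul_assoc := by
    rintro ⟨A⟩ ⟨B⟩ ⟨C⟩
    exact Quotient.sound (concat_assoc_equiv A B C)
  one_mul := by
    rintro ⟨A⟩
    refine toClass_eq_of_isometry (LinearMap.snd ℝ PUnit A.Chain) Prod.snd_surjective ?_ ?_ <;>
      rintro ⟨x, y⟩ <;> simp
  mul_one := by
    rintro ⟨A⟩
    refine toClass_eq_of_isometry (LinearMap.fst ℝ A.Chain PUnit) Prod.fst_surjective ?_ ?_ <;>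
      rintro ⟨x, y⟩ <;> simp

theorem toClass_empty : empty.toClass = 1 := rfl

/-- The signature of the surface that consists of a single piece of the given class. -/
noncomputable def sig : BandClass → ℤ :=
  Quotient.lift BandSpace.sig fun _ _ => sig_eq_of_equiv

theorem sig_toClass (A : BandSpace) : sig A.toClass = A.sig := rfl

theorem sig_mul_comm (x y : BandClass) : sig (x * y) = sig (y * x) := by
  obtain ⟨A⟩ := x
  obtain ⟨B⟩ := y
  exact sig_concat_comm A B

/-- The class of a letter of real weight. -/
noncomputable def letter (i : ℕ) (w : ℝ) : BandClass := (BandSpace.letter i w).toClass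

/-- The class of a negative square. -/
noncomputable def negativeLine : BandClass := (line (-1)).toClass

/-- The class of the plane `BandSpace.twistPlane`. -/
noncomputable def twist : BandClass := twistPlane.toClass

theorem sig_line_mul (c : ℝ) (x : BandClass) :
    sig ((line c).toClass * x) = SignType.sign c + sig x := by
  obtain ⟨X⟩ := x
  exact sig_line_concat c X

theorem toClass_line_of_neg {c : ℝ} (hc : c < 0) : (line c).toClass = negativeLine :=
  Quotient.sound fun X => by
    simp only [sig_line_concat, sign_neg hc, sign_neg (neg_one_lt_zero (R := ℝ))]

theorem negativeLine_commute (x : BandClass) : Commute negativeLine x := by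
  obtain ⟨X⟩ := x
  refine toClass_eq_of_isometry (LinearEquiv.prodComm ℝ ℝ X.Chain).toLinearMap
    (LinearEquiv.surjective _) ?_ ?_ <;> rintro ⟨t, x⟩ <;> simp [add_comm]

theorem sig_negativeLine_pow_mul (n : ℕ) (x : BandClass) :
    sig (negativeLine ^ n * x) = sig x - n := by
  induction n with
  | zero => simp
  | succ n ih =>
    rw [pow_succ', mul_assoc, negativeLine, sig_line_mul, ← negativeLine, ih,
      sign_neg (neg_one_lt_zero (R := ℝ)), SignType.coe_neg_one]
    push_cast
    ring

theorem toClass_hyperbolic (i : ℕ) : (hyperbolic i).toClass = 1 :=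
  Quotient.sound fun X => by
    rw [sig_hyperbolic_concat, sig_concat_comm, sig_concat_empty]

theorem letter_mul_letter_neg (i : ℕ) {w : ℝ} (hw : w ≠ 0) : letter i w * letter i (-w) = 1 := by
  rw [← toClass_hyperbolic i]
  let f : ℝ × ℝ →ₗ[ℝ] ℝ × ℝ :=
    { toFun := fun x => (x.1 + x.2, -w * (x.1 - x.2))
      map_add' := fun x y => by ext <;> simp only [Prod.fst_add, Prod.snd_add] <;> ring
      map_smul' := fun c x => by
        ext <;> simp only [Prod.smul_fst, Prod.smul_snd, smul_eq_mul, RingHom.id_apply] <;> ring }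
  refine toClass_eq_of_isometry f ?_ ?_ ?_
  · rintro ⟨p, d⟩
    refine ⟨((p - d / w) / 2, (p + d / w) / 2), ?_⟩
    ext <;> simp only [f, LinearMap.coe_mk, AddHom.coe_mk] <;> field_simp <;> ring
  · rintro ⟨a, b⟩
    simp only [f, LinearMap.coe_mk, AddHom.coe_mk, ↓concat_form, ↓letter_form, ↓letter_boundary,
      ↓hyperbolic_form, pairing_single_single, left_eq_add, one_ne_zero, if_false, mul_zero,
      add_zero]
    ring
  · rintro ⟨a, b⟩
    simp [f]

theorem letter_commute {i j : ℕ} (hij : i + 1 < j) (v w : ℝ) :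
    Commute (letter i v) (letter j w) := by
  refine toClass_eq_of_isometry (LinearEquiv.prodComm ℝ ℝ ℝ).toLinearMap
    (LinearEquiv.surjective _) ?_ ?_ <;> rintro ⟨a, b⟩
  · simp [pairing_single_single, show i ≠ j + 1 by omega, show j ≠ i + 1 by omega, add_comm]
  · simp [add_comm]

theorem letter_braid (i : ℕ) :
    letter i 1 * letter (i + 1) 1 * letter i 1 =
      letter (i + 1) 1 * letter i 1 * letter (i + 1) 1 := by
  let f : (ℝ × ℝ) × ℝ →ₗ[ℝ] (ℝ × ℝ) × ℝ :=
    { toFun := fun x => ((x.2, x.1.1 + x.2), x.1.2 - x.2)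
      map_add' := fun x y => by ext <;> simp only [Prod.fst_add, Prod.snd_add] <;> ring
      map_smul' := fun c x => by
        ext <;> simp only [Prod.smul_fst, Prod.smul_snd, smul_eq_mul, RingHom.id_apply] <;> ring }
  refine toClass_eq_of_isometry f ?_ ?_ ?_
  · rintro ⟨⟨a, b⟩, c⟩
    exact ⟨((b - a, a + c), a), by simp [f]⟩
  · rintro ⟨⟨a, b⟩, c⟩
    simp only [f, LinearMap.coe_mk, AddHom.coe_mk, ↓concat_form, ↓concat_boundary, ↓letter_form,
      ↓letter_boundary, map_add, LinearMap.add_apply, pairing_single_single,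
      show i ≠ i + 1 + 1 by omega, left_eq_add, one_ne_zero, if_true, if_false, mul_zero, add_zero,
      zero_add]
    ring
  · rintro ⟨⟨a, b⟩, c⟩
    simp only [f, LinearMap.coe_mk, AddHom.coe_mk, ↓concat_boundary, ↓letter_boundary,
      Finsupp.single_add, Finsupp.single_sub]
    abel

theorem letter_mul_letter (i : ℕ) {v w : ℝ} (hv : 0 < v) (hw : 0 < w) :
    letter i v * letter i w = negativeLine * letter i (v * w / (v + w)) := by
  have hvw : v + w ≠ 0 := (add_pos hv hw).ne'
  rw [← toClass_line_of_neg (neg_neg_of_pos (add_pos hv hw))]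
  let f : ℝ × ℝ →ₗ[ℝ] ℝ × ℝ :=
    { toFun := fun x => ((v * x.1 - w * x.2) / (v + w), x.1 + x.2)
      map_add' := fun x y => by ext <;> simp only [Prod.fst_add, Prod.snd_add] <;> ring
      map_smul' := fun c x => by
        ext <;> simp only [Prod.smul_fst, Prod.smul_snd, smul_eq_mul, RingHom.id_apply] <;> ring }
  refine toClass_eq_of_isometry f ?_ ?_ ?_
  · rintro ⟨y, s⟩
    refine ⟨(y + w * s / (v + w), v * s / (v + w) - y), ?_⟩
    ext <;> simp only [f, LinearMap.coe_mk, AddHom.coe_mk] <;> field_simp <;> ring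
  · rintro ⟨a, b⟩
    simp only [f, LinearMap.coe_mk, AddHom.coe_mk, ↓concat_form, ↓line_form, ↓line_boundary,
      ↓letter_form, ↓letter_boundary, pairing_single_single, left_eq_add, one_ne_zero, if_false,
      mul_zero, add_zero, map_zero, LinearMap.zero_apply]
    field_simp
    ring
  · rintro ⟨a, b⟩
    simp [f]

theorem letter_one_pow (i n : ℕ) :
    letter i 1 ^ (n + 1) = negativeLine ^ n * letter i (1 / (n + 1)) := by
  induction n with
  | zero => simp
  | succ n ih =>
    have hn : (0 : ℝ) < 1 / (n + 1) := by positivity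
    have hweight : (1 / (n + 1) * 1 / (1 / (n + 1) + 1) : ℝ) = 1 / ((n + 1 : ℕ) + 1) := by
      push_cast
      field_simp
      ring
    rw [pow_succ, ih, mul_assoc, letter_mul_letter i hn one_pos, hweight, ← mul_assoc, ← pow_succ]

theorem letter_full_twist :
    (letter 1 1 * letter 0 1) ^ 3 = negativeLine ^ 4 * twist := by
  -- Subtract `p q` and complete the squares of `b₁`, `b₂`, `b₃`: one negative square is left.
  let f : (((((ℝ × ℝ) × ℝ) × ℝ) × ℝ) × ℝ) →ₗ[ℝ] ((((ℝ × ℝ) × ℝ) × ℝ) × (ℝ × ℝ)) :=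
    { toFun := fun ⟨⟨⟨⟨⟨b₁, a₁⟩, b₂⟩, a₂⟩, b₃⟩, a₃⟩ =>
        ((((b₁ - (a₁ + a₂ + a₃) / 2, b₂ - (-a₁ + a₂ + a₃) / 2), b₃ - (-a₁ - a₂ + a₃) / 2),
          (a₁ - a₂ + a₃) / 2), (a₁ + a₂ + a₃, b₁ + b₂ + b₃))
      map_add' := fun x y => by ext <;> simp only [Prod.fst_add, Prod.snd_add] <;> ring
      map_smul' := fun c x => by
        ext <;> simp only [Prod.smul_fst, Prod.smul_snd, smul_eq_mul, RingHom.id_apply] <;> ring }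
  have hword : (letter 1 1 * letter 0 1) ^ 3 =
      letter 1 1 * letter 0 1 * letter 1 1 * letter 0 1 * letter 1 1 * letter 0 1 := by
    simp only [pow_succ, pow_zero, one_mul, mul_assoc]
  have hlines : negativeLine ^ 4 = negativeLine * negativeLine * negativeLine * negativeLine := by
    simp only [pow_succ, pow_zero, one_mul]
  rw [hword, hlines]
  refine toClass_eq_of_isometry f ?_ ?_ ?_
  · rintro ⟨⟨⟨⟨y₁, y₂⟩, y₃⟩, y₄⟩, p, q⟩
    let a₂ := p / 2 - y₄
    let d := q - (y₁ + y₂ + y₃) - p / 2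
    let a₁ := (p / 2 + y₄ - d) / 2
    let a₃ := (p / 2 + y₄ + d) / 2
    refine ⟨(((((y₁ + p / 2, a₁), y₂ + p / 2 - a₁), a₂), y₃ + a₃ - p / 2), a₃), ?_⟩
    ext <;> simp only [f, a₁, a₂, a₃, d, LinearMap.coe_mk, AddHom.coe_mk] <;> ring
  · rintro ⟨⟨⟨⟨⟨b₁, a₁⟩, b₂⟩, a₂⟩, b₃⟩, a₃⟩
    simp only [f, LinearMap.coe_mk, AddHom.coe_mk, ↓concat_form, ↓concat_boundary, ↓line_form,
      ↓line_boundary, ↓letter_form, ↓letter_boundary, ↓twistPlane_form, ↓twistPlane_boundary,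
      map_add, LinearMap.add_apply, pairing_single_single, Nat.reduceAdd, zero_ne_one,
      OfNat.zero_ne_ofNat, OfNat.one_ne_ofNat, if_true, if_false, mul_zero, add_zero, zero_add,
      map_zero, LinearMap.zero_apply]
    ring
  · rintro ⟨⟨⟨⟨⟨b₁, a₁⟩, b₂⟩, a₂⟩, b₃⟩, a₃⟩
    simp only [f, LinearMap.coe_mk, AddHom.coe_mk, ↓concat_boundary, ↓line_boundary,
      ↓letter_boundary, ↓twistPlane_boundary, Finsupp.single_add, zero_add]
    abel

theorem twist_mul_twist : twist * twist = 1 := by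
  let f : (ℝ × ℝ) × (ℝ × ℝ) →ₗ[ℝ] (ℝ × ℝ) × (ℝ × ℝ) :=
    { toFun := fun ⟨⟨p, q⟩, ⟨p', q'⟩⟩ => ((p + p', q), (q + q', p'))
      map_add' := fun x y => by ext <;> simp only [Prod.fst_add, Prod.snd_add] <;> ring
      map_smul' := fun c x => by
        ext <;> simp only [Prod.smul_fst, Prod.smul_snd, smul_eq_mul, RingHom.id_apply] <;> ring }
  calc twist * twist = (hyperbolic 0).toClass * (hyperbolic 1).toClass := by
        refine toClass_eq_of_isometry f ?_ ?_ ?_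
        · rintro ⟨⟨s, q⟩, ⟨t, p'⟩⟩
          exact ⟨((s - p', q), (p', t - q)), by simp [f]⟩
        · rintro ⟨⟨p, q⟩, ⟨p', q'⟩⟩
          simp only [f, LinearMap.coe_mk, AddHom.coe_mk, ↓concat_form, ↓twistPlane_form,
            ↓twistPlane_boundary, ↓hyperbolic_form, ↓hyperbolic_boundary, map_add,
            LinearMap.add_apply, pairing_single_single, Nat.reduceAdd, zero_ne_one,
            OfNat.zero_ne_ofNat, OfNat.one_ne_ofNat, if_true, if_false, mul_zero, add_zero,
            zero_add]
          ring
        · rintro ⟨⟨p, q⟩, ⟨p', q'⟩⟩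
          simp only [f, LinearMap.coe_mk, AddHom.coe_mk, ↓concat_boundary, ↓twistPlane_boundary,
            ↓hyperbolic_boundary, Finsupp.single_add]
          abel
    _ = 1 := by rw [toClass_hyperbolic, toClass_hyperbolic, one_mul]

end BandClass

end BandClass

section SeifertForm

namespace BraidWord

open BandSpace Matrix

variable (w : BraidWord)

/-- A Gram matrix of a form on all chains of bands, not only on the cycles. The entries `2` stand
for the two entries `1` at `(s, t)` and `(t, s)` of a symmetric matrix. -/
noncomputable def gram : Matrix (Fin w.word.length) (Fin w.word.length) ℝ :=
  Matrix.of fun s t => if s = t then -(w.sign s : ℝ)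
    else if s < t ∧ (w.gen s : ℕ) = w.gen t + 1 then 2 else 0

/-- The bands of the Seifert surface of the closure of a braid word. -/
@[reducible]
noncomputable def bandSpace : BandSpace where
  Chain := Fin w.word.length → ℝ
  form := w.gram.toQuadraticForm'
  boundary := ∑ t, Finsupp.lsingle (w.gen t : ℕ) ∘ₗ LinearMap.proj t

theorem bandSpace_form (c : Fin w.word.length → ℝ) :
    w.bandSpace.form c = ∑ s, ∑ t, c s * (w.gram s t * c t) := by
  simp [Matrix.toQuadraticForm', Matrix.toLinearMap₂'_apply', dotProduct, Matrix.mulVec,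
    Finset.mul_sum]

theorem bandSpace_boundary (c : Fin w.word.length → ℝ) :
    w.bandSpace.boundary c = ∑ t, Finsupp.single (w.gen t : ℕ) (c t) := by
  simp

/-- The class of the band of a letter of a braid word. -/
noncomputable def crossing {n : ℕ} (x : Fin n × Bool) : BandClass :=
  .letter x.1 (if x.2 then 1 else -1)

theorem bandSpace_form_cons {n : ℕ} (x : Fin n × Bool) (l : List (Fin n × Bool))
    (c : Fin (l.length + 1) → ℝ) :
    (bandSpace ⟨n, x :: l⟩).form c =
      ((BandSpace.letter x.1 (if x.2 then 1 else -1)).concat (bandSpace ⟨n, l⟩)).form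
        (c 0, fun t => c t.succ) := by
  have hhead : gram ⟨n, x :: l⟩ 0 0 = -if x.2 then 1 else -1 := by
    have hsign : sign ⟨n, x :: l⟩ (0 : Fin (l.length + 1)) = if x.2 then 1 else -1 := rfl
    simp only [gram, Matrix.of_apply, if_true, hsign, Int.cast_ite, Int.cast_one, Int.cast_neg]
  have hrow : ∀ t : Fin l.length, gram ⟨n, x :: l⟩ 0 t.succ =
      if (x.1 : ℕ) = gen ⟨n, l⟩ t + 1 then 2 else 0 := by
    intro t
    simp only [gram, Matrix.of_apply, (Fin.succ_ne_zero t).symm, if_false, Fin.succ_pos, true_and]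
    rfl
  have hcolumn : ∀ t : Fin l.length, gram ⟨n, x :: l⟩ t.succ 0 = 0 := by
    intro t
    simp [gram]
  have htail : ∀ s t : Fin l.length, gram ⟨n, x :: l⟩ s.succ t.succ = gram ⟨n, l⟩ s t := by
    intro s t
    simp only [gram, Matrix.of_apply, Fin.succ_inj, Fin.succ_lt_succ_iff]
    rfl
  have hform : (bandSpace ⟨n, x :: l⟩).form c = ∑ s : Fin (l.length + 1),
      ∑ t : Fin (l.length + 1), c s * (gram ⟨n, x :: l⟩ s t * c t) :=
    bandSpace_form ⟨n, x :: l⟩ c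
  have hlink : ∑ t : Fin l.length,
      c 0 * ((if (x.1 : ℕ) = gen ⟨n, l⟩ t + 1 then 2 else 0) * c t.succ) =
      2 * ∑ t : Fin l.length, if (x.1 : ℕ) = gen ⟨n, l⟩ t + 1 then c 0 * c t.succ else 0 := by
    rw [Finset.mul_sum]
    refine Finset.sum_congr rfl fun t _ => ?_
    split_ifs <;> ring
  rw [hform, concat_form, bandSpace_form, bandSpace_boundary, letter_form, letter_boundary]
  simp only [Fin.sum_univ_succ, hhead, hrow, hcolumn, htail, hlink, zero_mul, mul_zero, zero_add,
    map_sum, pairing_single_single]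
  ring

theorem bandSpace_boundary_cons {n : ℕ} (x : Fin n × Bool) (l : List (Fin n × Bool))
    (c : Fin (l.length + 1) → ℝ) :
    (bandSpace ⟨n, x :: l⟩).boundary c =
      ((BandSpace.letter x.1 (if x.2 then 1 else -1)).concat (bandSpace ⟨n, l⟩)).boundary
        (c 0, fun t => c t.succ) := by
  rw [concat_boundary, bandSpace_boundary, bandSpace_boundary]
  exact Fin.sum_univ_succ (n := l.length) fun t =>
    Finsupp.single (gen ⟨n, x :: l⟩ t : ℕ) (c t)

theorem toClass_bandSpace_cons {n : ℕ} (x : Fin n × Bool) (l : List (Fin n × Bool)) :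
    (bandSpace ⟨n, x :: l⟩).toClass = crossing x * (bandSpace ⟨n, l⟩).toClass := by
  let f : (Fin (l.length + 1) → ℝ) →ₗ[ℝ] ℝ × (Fin l.length → ℝ) :=
    (LinearMap.proj 0).prod (LinearMap.funLeft ℝ ℝ Fin.succ)
  exact toClass_eq_of_isometry f (fun y => ⟨Fin.cons y.1 y.2, rfl⟩)
    (fun c => (bandSpace_form_cons x l c).symm) fun c => (bandSpace_boundary_cons x l c).symm

theorem toClass_bandSpace : w.bandSpace.toClass = (w.word.map crossing).prod := by
  obtain ⟨n, l⟩ := w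
  induction l with
  | nil => exact toClass_eq_of_isometry 0 (fun _ => ⟨0, rfl⟩) (fun _ => rfl) (fun _ => rfl)
  | cons x l ih => rw [toClass_bandSpace_cons, ih, List.map_cons, List.prod_cons]

/-- The matrix that writes each loop as the difference of its two bands. -/
def incidence : Matrix (Fin w.word.length) w.Loop ℝ :=
  Matrix.of fun r p => (if r = p.1.1 then 1 else 0) - (if r = p.1.2 then 1 else 0)

/-- The matrix of the form of `BraidWord.gram` on the loops. -/
noncomputable def loopGram : Matrix w.Loop w.Loop ℝ :=
  w.incidence.transpose * w.gram * w.incidence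

theorem loopGram_apply (p q : w.Loop) :
    w.loopGram p q = w.gram p.1.1 q.1.1 - w.gram p.1.2 q.1.1 -
      (w.gram p.1.1 q.1.2 - w.gram p.1.2 q.1.2) := by
  simp [loopGram, Matrix.mul_apply, incidence, sub_mul, mul_sub, Finset.sum_sub_distrib]

theorem sign_eq_one_or_neg_one (t : Fin w.word.length) : w.sign t = 1 ∨ w.sign t = -1 := by
  simp only [sign]
  split_ifs <;> simp

theorem gram_apply_of_gen_eq {s t : Fin w.word.length} (h : w.gen s = w.gen t) :
    w.gram s t = if s = t then -(w.sign s : ℝ) else 0 := by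
  simp [gram, h]

theorem gram_apply_of_gen_ne {s t : Fin w.word.length} (h : w.gen s ≠ w.gen t) :
    w.gram s t = if s < t ∧ (w.gen s : ℕ) = w.gen t + 1 then 2 else 0 := by
  have hst : s ≠ t := fun hst => h (congrArg w.gen hst)
  simp [gram, hst]

variable {w} {p q : w.Loop}

theorem two_mul_symm_seifertMatrix_apply_self (p : w.Loop) :
    2 * ((w.seifertMatrix p p : ℝ) + w.seifertMatrix p p) = w.loopGram p p + w.loopGram p p := by
  obtain ⟨⟨s, t⟩, hst, hgen, -⟩ := p
  replace hgen : w.gen s = w.gen t := hgen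
  replace hst : s < t := hst
  rw [loopGram_apply]
  simp only [gram_apply_of_gen_eq, hgen, hst.ne, hst.ne', if_true, if_false, seifertMatrix,
    Matrix.of_apply]
  rcases w.sign_eq_one_or_neg_one s with hs | hs <;>
    rcases w.sign_eq_one_or_neg_one t with ht | ht <;> rw [hs, ht] <;> norm_num

theorem fst_ne_fst_of_ne (hpq : p ≠ q) : p.1.1 ≠ q.1.1 := by
  obtain ⟨⟨s, t⟩, hst, hgen, hbetween⟩ := p
  obtain ⟨⟨s', t'⟩, hst', hgen', hbetween'⟩ := q
  rintro rfl
  rcases lt_trichotomy t t' with h | rfl | h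
  · exact hbetween' t hst h hgen.symm
  · exact hpq rfl
  · exact hbetween t' hst' h hgen'.symm

theorem snd_ne_snd_of_ne (hpq : p ≠ q) : p.1.2 ≠ q.1.2 := by
  obtain ⟨⟨s, t⟩, hst, hgen, hbetween⟩ := p
  obtain ⟨⟨s', t'⟩, hst', hgen', hbetween'⟩ := q
  rintro rfl
  rcases lt_trichotomy s s' with h | rfl | h
  · exact hbetween s' h hst' (hgen'.trans hgen.symm)
  · exact hpq rfl
  · exact hbetween' s h hst (hgen.trans hgen'.symm)

theorem two_mul_symm_seifertMatrix_apply_of_gen_eq (hpq : p ≠ q)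
    (hgen : w.gen p.1.1 = w.gen q.1.1) :
    2 * ((w.seifertMatrix p q : ℝ) + w.seifertMatrix q p) = w.loopGram p q + w.loopGram q p := by
  have hfst := fst_ne_fst_of_ne hpq
  have hsnd := snd_ne_snd_of_ne hpq
  have hp : w.gen p.1.2 = w.gen q.1.1 := p.2.2.1.symm.trans hgen
  have hq : w.gen q.1.2 = w.gen q.1.1 := q.2.2.1.symm
  have hlevel : ¬ ((w.gen q.1.1 : ℕ) = w.gen q.1.1 + 1) := (Nat.lt_succ_self _).ne
  simp only [loopGram_apply, gram_apply_of_gen_eq, hgen, hp, hq, hfst, hfst.symm, hsnd, hsnd.symm,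
    seifertMatrix, Matrix.of_apply, hpq, hpq.symm, hlevel, if_false, eq_comm (a := q.1.1),
    eq_comm (a := p.1.1)]
  by_cases hpq' : p.1.2 = q.1.1
  · have hqp' : q.1.2 ≠ p.1.1 := fun hqp' => lt_asymm (hpq' ▸ p.2.1) (hqp' ▸ q.2.1)
    rcases w.sign_eq_one_or_neg_one q.1.1 with hsign | hsign <;>
      norm_num [hpq', hqp', hsign]
  by_cases hqp' : q.1.2 = p.1.1
  · rcases w.sign_eq_one_or_neg_one p.1.1 with hsign | hsign <;>
      norm_num [hpq', hqp', hsign]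
  · norm_num [hpq', hqp']

theorem interleaving_sum {n : ℕ} {s t s' t' : Fin n} (hst : s < t) (hst' : s' < t') (hss : s ≠ s')
    (htt : t ≠ t') (hts' : t ≠ s') (ht's : t' ≠ s) :
    2 * (((if s < s' ∧ s' < t ∧ t < t' then 1 else if s' < s ∧ s < t' ∧ t' < t then -1 else 0 : ℤ)
      : ℝ)) =
    (if s < s' then 2 else 0) - (if t < s' then 2 else 0) -
      ((if s < t' then 2 else 0) - (if t < t' then 2 else 0)) := by
  split_ifs <;> first | omega | norm_num

theorem two_mul_seifertMatrix_apply_of_gen_ne (hgen : w.gen p.1.1 ≠ w.gen q.1.1) :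
    2 * (w.seifertMatrix p q : ℝ) = w.loopGram p q := by
  have hp : w.gen p.1.2 = w.gen p.1.1 := p.2.2.1.symm
  have hq : w.gen q.1.2 = w.gen q.1.1 := q.2.2.1.symm
  have hpq : p ≠ q := fun h => hgen (by rw [h])
  have hfst : p.1.1 ≠ q.1.1 := fun h => hgen (by rw [h])
  have hsnd : p.1.2 ≠ q.1.2 := fun h => hgen (by rw [← hp, h, hq])
  have hpq' : p.1.2 ≠ q.1.1 := fun h => hgen (by rw [← hp, h])
  have hqp' : q.1.2 ≠ p.1.1 := fun h => hgen (by rw [← hq, h])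
  simp only [loopGram_apply, gram_apply_of_gen_ne, hgen, hp, hq, ne_eq, not_false_eq_true,
    seifertMatrix, Matrix.of_apply, hpq, hpq', hqp', if_false]
  by_cases hlevel : (w.gen p.1.1 : ℕ) = w.gen q.1.1 + 1
  · simp only [eq_true hlevel, and_true, if_true]
    exact interleaving_sum p.2.1 q.2.1 hfst hsnd hpq' hqp'
  · simp only [hlevel, and_false, if_false]
    norm_num

theorem two_mul_symm_seifertMatrix_apply (p q : w.Loop) :
    2 * ((w.seifertMatrix p q : ℝ) + w.seifertMatrix q p) = w.loopGram p q + w.loopGram q p := by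
  rcases eq_or_ne p q with rfl | hpq
  · exact two_mul_symm_seifertMatrix_apply_self p
  by_cases hgen : w.gen p.1.1 = w.gen q.1.1
  · exact two_mul_symm_seifertMatrix_apply_of_gen_eq hpq hgen
  · rw [mul_add, two_mul_seifertMatrix_apply_of_gen_ne hgen,
      two_mul_seifertMatrix_apply_of_gen_ne (Ne.symm hgen)]

variable (w)

theorem sub_mem_range_incidence (s t : Fin w.word.length) (hst : s ≤ t) (h : w.gen s = w.gen t) :
    (Pi.single s 1 - Pi.single t 1 : Fin w.word.length → ℝ) ∈
      LinearMap.range w.incidence.mulVecLin := by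
  induction hn : (t : ℕ) - s using Nat.strong_induction_on generalizing s t with
  | _ n ih =>
    rcases hst.eq_or_lt with rfl | hlt
    · simp
    by_cases hbetween : ∃ r, s < r ∧ r < t ∧ w.gen r = w.gen s
    · obtain ⟨r, hsr, hrt, hr⟩ := hbetween
      have hsum := add_mem (ih _ (by omega) s r hsr.le hr.symm rfl)
        (ih _ (by omega) r t hrt.le (hr.trans h) rfl)
      rwa [sub_add_sub_cancel] at hsum
    · push Not at hbetween
      let p : w.Loop := ⟨(s, t), hlt, h, hbetween⟩
      refine ⟨Pi.single p 1, ?_⟩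
      ext r
      simp [incidence, p, Pi.single_apply]

theorem boundary_incidence_mulVec (x : w.Loop → ℝ) :
    w.bandSpace.boundary (w.incidence *ᵥ x) = 0 := by
  have hloop : ∀ p : w.Loop, ∑ t, w.incidence t p • Finsupp.single (w.gen t : ℕ) (1 : ℝ) = 0 := by
    intro p
    have hgen : w.gen p.1.1 = w.gen p.1.2 := p.2.2.1
    simp [incidence, sub_smul, ite_smul, Finset.sum_sub_distrib, hgen]
  calc w.bandSpace.boundary (w.incidence *ᵥ x)
      = ∑ t, ∑ p, x p • w.incidence t p • Finsupp.single (w.gen t : ℕ) (1 : ℝ) := by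
        rw [bandSpace_boundary]
        refine Finset.sum_congr rfl fun t _ => ?_
        simp only [Matrix.mulVec, dotProduct, Finsupp.single_finsetSum, Finsupp.smul_single,
          smul_eq_mul, mul_one, mul_comm]
    _ = ∑ p, x p • ∑ t, w.incidence t p • Finsupp.single (w.gen t : ℕ) (1 : ℝ) := by
        rw [Finset.sum_comm]
        simp only [Finset.smul_sum]
    _ = 0 := by simp only [hloop, smul_zero, Finset.sum_const_zero]

theorem exists_incidence_mulVec_eq {c : Fin w.word.length → ℝ} (hc : w.bandSpace.boundary c = 0) :
    ∃ x, w.incidence *ᵥ x = c := by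
  classical
  let E : ℕ → Fin w.word.length → ℝ := fun i =>
    if h : ∃ t, (w.gen t : ℕ) = i then Pi.single h.choose 1 else 0
  have hE : ∀ t, Pi.single t 1 - E (w.gen t) ∈ LinearMap.range w.incidence.mulVecLin := by
    intro t
    have h : ∃ s, (w.gen s : ℕ) = w.gen t := ⟨t, rfl⟩
    have hs : w.gen h.choose = w.gen t := Fin.ext h.choose_spec
    simp only [E, dif_pos h]
    rcases le_total t h.choose with hle | hle
    · exact w.sub_mem_range_incidence _ _ hle hs.symm
    · simpa only [neg_sub] using neg_mem (w.sub_mem_range_incidence _ _ hle hs)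
  have hcE : ∑ t, c t • E (w.gen t) = 0 := by
    rw [bandSpace_boundary] at hc
    simpa [map_sum] using congrArg (Finsupp.linearCombination ℝ E) hc
  have hcsum : c = ∑ t, c t • (Pi.single t 1 - E (w.gen t)) := by
    simp only [smul_sub, Finset.sum_sub_distrib, hcE, sub_zero]
    ext s
    simp [Finset.sum_apply, Pi.single_apply]
  have hrange : c ∈ LinearMap.range w.incidence.mulVecLin :=
    hcsum ▸ Submodule.sum_mem _ fun t _ => Submodule.smul_mem _ _ (hE t)
  exact hrange

theorem bandSpace_form_incidence_mulVec (x : w.Loop → ℝ) :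
    w.bandSpace.form (w.incidence *ᵥ x) = x ⬝ᵥ w.loopGram *ᵥ x := by
  rw [loopGram, ← Matrix.mulVec_mulVec, ← Matrix.mulVec_mulVec, Matrix.dotProduct_mulVec,
    Matrix.vecMul_transpose]
  exact Matrix.toLinearMap₂'_apply' w.gram (w.incidence *ᵥ x) (w.incidence *ᵥ x)

theorem toQuadraticForm'_symm_seifertMatrix (x : w.Loop → ℝ) :
    ((w.seifertMatrix + w.seifertMatrix.transpose).map (Int.cast : ℤ → ℝ)).toQuadraticForm' x =
      w.bandSpace.form (w.incidence *ᵥ x) := by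
  have hmatrix : (2 : ℝ) • (w.seifertMatrix + w.seifertMatrix.transpose).map (Int.cast : ℤ → ℝ) =
      w.loopGram + w.loopGram.transpose := by
    ext p q
    simpa using two_mul_symm_seifertMatrix_apply p q
  have htranspose : x ⬝ᵥ w.loopGram.transpose *ᵥ x = x ⬝ᵥ w.loopGram *ᵥ x := by
    rw [Matrix.mulVec_transpose, dotProduct_comm, ← Matrix.dotProduct_mulVec]
  have htwice := congrArg (fun A => x ⬝ᵥ A *ᵥ x) hmatrix
  simp only [Matrix.smul_mulVec, dotProduct_smul, Matrix.add_mulVec, dotProduct_add, htranspose,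
    smul_eq_mul] at htwice
  rw [bandSpace_form_incidence_mulVec, Matrix.toQuadraticForm',
    LinearMap.BilinMap.toQuadraticMap_apply, Matrix.toLinearMap₂'_apply']
  linarith

theorem signature_eq_sig_bandSpace : w.signature = w.bandSpace.sig := by
  let V := (w.seifertMatrix + w.seifertMatrix.transpose).map (Int.cast : ℤ → ℝ)
  let f : V.toQuadraticForm' →qᵢ w.bandSpace.form.restrict (LinearMap.ker w.bandSpace.boundary) :=
    { LinearMap.codRestrict _ w.incidence.mulVecLin w.boundary_incidence_mulVec with
      map_app' := fun x => (w.toQuadraticForm'_symm_seifertMatrix x).symm }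
  refine formSignature_eq_of_surjective f ?_
  rintro ⟨c, hc⟩
  obtain ⟨x, rfl⟩ := w.exists_incidence_mulVec_eq hc
  exact ⟨x, rfl⟩

theorem signature_eq_sig : w.signature = BandClass.sig (w.word.map crossing).prod := by
  rw [signature_eq_sig_bandSpace, ← toClass_bandSpace, BandClass.sig_toClass]

end BraidWord

end SeifertForm

section MarkovInvariance

namespace BraidWord

open BandSpace BandClass

theorem map_crossing_map_castSucc {n : ℕ} (u : List (Fin n × Bool)) :
    (u.map fun x => (x.1.castSucc, x.2)).map crossing = u.map crossing := by
  rw [List.map_map]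
  rfl

theorem crossing_mul_crossing_not {n : ℕ} (i : Fin n) (e : Bool) :
    crossing (i, e) * crossing (i, !e) = 1 := by
  cases e
  · simpa [crossing] using letter_mul_letter_neg (i : ℕ) (w := -1) (by norm_num)
  · simpa [crossing] using letter_mul_letter_neg (i : ℕ) one_ne_zero

theorem sig_prod_mul_letter (w : BraidWord) {i : ℕ} (hi : w.gens ≤ i) (v : ℝ) :
    BandClass.sig ((w.word.map crossing).prod * .letter i v) =
      BandClass.sig (w.word.map crossing).prod := by
  have hboundary : ∀ c, w.bandSpace.boundary c i = 0 := fun c => by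
    rw [bandSpace_boundary, Finsupp.finsetSum_apply]
    exact Finset.sum_eq_zero fun t _ =>
      Finsupp.single_eq_of_ne ((w.gen t).isLt.trans_le hi).ne'
  rw [← toClass_bandSpace]
  exact sig_concat_letter_of_boundary_eq_zero hboundary v

theorem signature_eq_of_markovMove {w w' : BraidWord} (h : MarkovMove w w') :
    w.signature = w'.signature := by
  rw [signature_eq_sig, signature_eq_sig]
  cases h with
  | cancel n u v i e =>
    simp only [List.map_append, List.map_cons, List.map_nil, List.prod_append, List.prod_cons,
      List.prod_nil, mul_one, crossing_mul_crossing_not]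
  | comm n u v i j hij =>
    have hcomm : crossing (i, true) * crossing (j, true) =
        crossing (j, true) * crossing (i, true) := letter_commute hij _ _
    simp only [List.map_append, List.map_cons, List.map_nil, List.prod_append, List.prod_cons,
      List.prod_nil, mul_one, hcomm]
  | braid n u v i j hij =>
    have hbraid : crossing (i, true) * (crossing (j, true) * crossing (i, true)) =
        crossing (j, true) * (crossing (i, true) * crossing (j, true)) := by
      simp only [crossing, if_true, ← hij, ← mul_assoc, letter_braid]
    simp only [List.map_append, List.map_cons, List.map_nil, List.prod_append, List.prod_cons,
      List.prod_nil, mul_one, hbraid]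
  | conj n x u =>
    simpa only [List.map_append, List.map_cons, List.map_nil, List.prod_append, List.prod_cons,
      List.prod_nil, mul_one] using sig_mul_comm (crossing x) (u.map crossing).prod
  | stab n u e =>
    have hstab : BandClass.sig ((u.map crossing).prod * crossing (Fin.last n, e)) =
        BandClass.sig (u.map crossing).prod := sig_prod_mul_letter ⟨n, u⟩ le_rfl _
    simp only [List.map_append, List.map_cons, List.map_nil, List.prod_append, List.prod_cons,
      List.prod_nil, mul_one, map_crossing_map_castSucc, hstab]

theorem signature_eq_of_closure_eq {w w' : BraidWord} (h : w.closure = w'.closure) :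
    w.signature = w'.signature := by
  have hmoves := Quot.eqvGen_exact h
  clear h
  induction hmoves with
  | rel _ _ h => exact signature_eq_of_markovMove h
  | refl => rfl
  | symm _ _ _ ih => exact ih.symm
  | trans _ _ _ _ _ ih ih' => exact ih.trans ih'

theorem hasSignature_closure (w : BraidWord) : w.closure.HasSignature w.signature :=
  fun _ h => signature_eq_of_closure_eq h

end BraidWord

end MarkovInvariance

section TwistedTorus

namespace BandClass

open BandSpace

theorem twist_pow_two_mul (n : ℕ) : twist ^ (2 * n) = 1 := by
  rw [pow_mul, pow_two, twist_mul_twist, one_pow]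

theorem sig_letter_one_mul_letter_zero (w : ℝ) : sig (letter 1 w * letter 0 1) = 0 := by
  calc sig (letter 1 w * letter 0 1) = sig (1 * letter 1 w) := by
        rw [one_mul]
        exact sig_concat_letter_of_boundary_eq_zero (fun b => Finsupp.single_eq_of_ne zero_ne_one) 1
    _ = sig 1 := sig_concat_letter_of_boundary_eq_zero (fun _ => rfl) w
    _ = 0 := sig_empty

theorem sig_letter_one_mul_letter_zero_mul_twist (w : ℝ) :
    sig (letter 1 w * letter 0 1 * twist) = SignType.sign (1 / 4 - w) - 1 := by
  let f : (ℝ × ℝ) × (ℝ × ℝ) →ₗ[ℝ] ℝ × (ℝ × PUnit) :=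
    { toFun := fun x => (x.1.2 - x.1.1 / 2, (x.1.1, 0))
      map_add' := fun x y => by ext <;> simp only [Prod.fst_add, Prod.snd_add]; ring
      map_smul' := fun c x => by
        ext <;> simp only [Prod.smul_fst, Prod.smul_snd, smul_eq_mul, RingHom.id_apply]; ring }
  have hcycle : ∀ b a p q : ℝ, Finsupp.single 1 b + Finsupp.single 0 a +
      (Finsupp.single 0 p + Finsupp.single 1 q) = 0 → p = -a ∧ q = -b := by
    intro b a p q h
    have hp : a + p = 0 := by simpa using DFunLike.congr_fun h 0
    have hq : b + q = 0 := by simpa using DFunLike.congr_fun h 1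
    exact ⟨eq_neg_of_add_eq_zero_right hp, eq_neg_of_add_eq_zero_right hq⟩
  have hsquares : sig (letter 1 w * letter 0 1 * twist) =
      sig (negativeLine * ((line (1 / 4 - w)).toClass * 1)) := by
    refine sig_eq_of_surjOn_ker f ?_ ?_ ?_
    · rintro ⟨⟨b, a⟩, p, q⟩ -
      simp [f]
    · rintro ⟨y, b, x⟩ -
      refine ⟨((b, y + b / 2), (-(y + b / 2), -b)), ?_, ?_⟩
      · rw [concat_boundary, concat_boundary, letter_boundary, letter_boundary,
          twistPlane_boundary, Finsupp.single_neg, Finsupp.single_neg]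
        abel
      · simp [f]
    · rintro ⟨⟨b, a⟩, p, q⟩ h
      obtain ⟨rfl, rfl⟩ := hcycle b a p q (by simpa using h)
      simp only [f, LinearMap.coe_mk, AddHom.coe_mk, ↓concat_form, ↓concat_boundary, ↓line_form,
        ↓line_boundary, ↓letter_form, ↓letter_boundary, ↓twistPlane_form, ↓twistPlane_boundary,
        ↓empty_form, ↓empty_boundary, map_zero, map_add, add_zero, zero_add, mul_zero,
        LinearMap.add_apply, pairing_single_single, Nat.reduceAdd, zero_ne_one,
        OfNat.zero_ne_ofNat, OfNat.one_ne_ofNat, if_true, if_false]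
      ring
  rw [hsquares, ← pow_one negativeLine, sig_negativeLine_pow_mul, sig_line_mul, ← toClass_empty,
    sig_toClass, sig_empty, add_zero, Nat.cast_one]

theorem letter_pow_mul_full_twist_pow (k r : ℕ) :
    letter 1 1 ^ r * (letter 1 1 * letter 0 1) ^ (3 * k + 1) =
      negativeLine ^ (r + 4 * k) * (letter 1 (1 / (r + 1)) * letter 0 1 * twist ^ k) := by
  have hfull : (letter 1 1 * letter 0 1) ^ (3 * k) = negativeLine ^ (4 * k) * twist ^ k := by
    rw [pow_mul, letter_full_twist, (negativeLine_commute twist).pow_left 4 |>.mul_pow, ← pow_mul]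
  have hcomm : letter 1 (1 / (r + 1)) * letter 0 1 * negativeLine ^ (4 * k) =
      negativeLine ^ (4 * k) * (letter 1 (1 / (r + 1)) * letter 0 1) :=
    ((negativeLine_commute _).pow_left _).symm
  calc letter 1 1 ^ r * (letter 1 1 * letter 0 1) ^ (3 * k + 1)
      = letter 1 1 ^ (r + 1) * letter 0 1 * (letter 1 1 * letter 0 1) ^ (3 * k) := by
        simp only [pow_succ', pow_succ (letter 1 1) r, mul_assoc]
    _ = negativeLine ^ r * (letter 1 (1 / (r + 1)) * letter 0 1 * negativeLine ^ (4 * k)) *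
          twist ^ k := by
        rw [letter_one_pow, hfull]
        simp only [mul_assoc]
    _ = _ := by rw [hcomm, pow_add]; simp only [mul_assoc]

end BandClass

theorem prod_map_crossing_twistedTorusBraid (q r : ℕ) :
    ((twistedTorusBraid q r).word.map BraidWord.crossing).prod =
      (.letter 1 1 * .letter 0 1) ^ q * .letter 1 1 ^ r := by
  simp [twistedTorusBraid, BraidWord.crossing, List.map_flatten, List.prod_flatten]

theorem sign_one_fourth_sub_one_div (r : ℕ) :
    (SignType.sign (1 / 4 - 1 / (r + 1) : ℝ) : ℤ) = Int.sign ((r : ℤ) - 3) := by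
  have hfactor : (((r : ℤ) - 3 : ℤ) : ℝ) = 4 * (r + 1) * (1 / 4 - 1 / (r + 1)) := by
    push_cast
    field_simp
    ring
  rw [Int.sign_eq_sign, ← sign_intCast (α := ℝ), hfactor, sign_mul,
    sign_pos (by positivity : (0 : ℝ) < 4 * (r + 1)), one_mul]

theorem signature_twistedTorusBraid (k r : ℕ) :
    (twistedTorusBraid (3 * k + 1) r).signature =
      -4 * (k : ℤ) - r + if Odd k then Int.sign ((r : ℤ) - 3) - 1 else 0 := by
  rw [BraidWord.signature_eq_sig, prod_map_crossing_twistedTorusBraid, BandClass.sig_mul_comm,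
    BandClass.letter_pow_mul_full_twist_pow, BandClass.sig_negativeLine_pow_mul]
  rcases Nat.even_or_odd' k with ⟨n, rfl | rfl⟩
  · rw [BandClass.twist_pow_two_mul, mul_one, BandClass.sig_letter_one_mul_letter_zero,
      if_neg (by simp)]
    push_cast
    ring
  · rw [pow_succ, BandClass.twist_pow_two_mul, one_mul,
      BandClass.sig_letter_one_mul_letter_zero_mul_twist, sign_one_fourth_sub_one_div,
      if_pos (by simp)]
    push_cast
    ring

theorem mainTheorem6_general (k r : ℕ) :
    (twistedTorusLink (3 * k + 1) r).HasSignature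
      (-4 * (k : ℤ) - r + if Odd k then Int.sign ((r : ℤ) - 3) - 1 else 0) := by
  rw [← signature_twistedTorusBraid]
  exact (twistedTorusBraid (3 * k + 1) r).hasSignature_closure

end TwistedTorus

theorem mainTheorem6 (k m : ℕ) (hk : 1 ≤ k) :
    (twistedTorusLink (3 * k + 1) (2 * m)).HasSignature
      (if Odd k ∧ (m = 0 ∨ m = 1) then -4 * (k : ℤ) - 2 * (m : ℤ) - 2
       else -4 * (k : ℤ) - 2 * (m : ℤ)) := by
  convert mainTheorem6_general k (2 * m) using 1
  by_cases hm : m = 0 ∨ m = 1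
  · have hsign : Int.sign (((2 * m : ℕ) : ℤ) - 3) = -1 := Int.sign_eq_neg_one_of_neg (by omega)
    simp only [hm, and_true, hsign]
    split_ifs <;> push_cast <;> ring
  · have hsign : Int.sign (((2 * m : ℕ) : ℤ) - 3) = 1 := Int.sign_eq_one_of_pos (by omega)
    simp only [hm, and_false, if_false, hsign, sub_self, ite_self]
    push_cast
    ring
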